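/- Let $H\in(0,1)$. A one-dimensional sub-fractional Brownian motion with index $H$ is a centered real-valued Gaussian process $S^H=(S^H_t)_{t\ge 0}$ with covariance function $$\mathbb{E}[S^H_sS^H_t]=s^{2H}+t^{2H}-\tfrac12\left[(s+t)^{2H}+|t-s|^{2H}\right],\qquad s,t\ge 0 .$$ For every $H\in(0,1)$ there exists a constant $\kappa_H>0$, depending only on $H$, such that every one-dimensional sub-fractional Brownian motion $S^H$ with index $H$ satisfies the following strong local nondeterminism property: for any integer $m\ge 1$ and any times $0=s_0<s_1\le\dots\le s_m<t<\infty$, $$\operatorname{Var}\left(S^H_t\mid S^H_{s_1},\dots,S^H_{s_m}\right)\ \ge\ \kappa_H\min_{1\le j\le m}|t-s_j|^{2H}\qquad\text{almost surely},$$ where $\operatorname{Var}(X\mid\mathcal F)=\mathbb{E}\left[(X-\mathbb{E}[X\mid\mathcal F])^2\mid\mathcal F\right]$ is the conditional variance and $\operatorname{Var}(X\mid X_1,\dots,X_m)$ stands for $\operatorname{Var}(X\mid\sigma(X_1,\dots,X_m))$. -/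

import Mathlib

open MeasureTheory ProbabilityTheory
open scoped NNReal

/-- A real-valued stochastic process `S = (S_t)_{t ≥ 0}` is a (one-dimensional) sub-fractional
Brownian motion with index `H` under `P` if it is a centered Gaussian process with covariance
function `E[S_s S_t] = s^{2H} + t^{2H} - ((s + t)^{2H} + |t - s|^{2H}) / 2`. -/
structure IsSubFractionalBrownianMotion {Ω : Type*} {mΩ : MeasurableSpace Ω}
    (H : ℝ) (S : ℝ≥0 → Ω → ℝ) (P : Measure Ω) : Prop where
  /-- every `S t` is a genuine random variable, so that `σ(S_{s₁}, …, S_{sₘ})` consists of events -/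
  measurable : ∀ t, Measurable (S t)
  isGaussianProcess : IsGaussianProcess S P
  centered : ∀ t, ∫ ω, S t ω ∂P = 0
  covariance_eq : ∀ s t : ℝ≥0,
    ∫ ω, S s ω * S t ω ∂P =
      (s : ℝ) ^ (2 * H) + (t : ℝ) ^ (2 * H)
        - (1 / 2) * (((s : ℝ) + (t : ℝ)) ^ (2 * H) + |(t : ℝ) - (s : ℝ)| ^ (2 * H))

/-- The σ-algebra `σ(S_{s₁}, …, S_{sₘ})` generated by finitely many values of a process. -/
abbrev sigmaOfValues {Ω : Type*} (S : ℝ≥0 → Ω → ℝ) {m : ℕ} (s : Fin m → ℝ≥0) :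
    MeasurableSpace Ω :=
  ⨆ j : Fin m, MeasurableSpace.comap (S (s j)) inferInstance

/-! For a Gaussian process the conditional variance is the deterministic error E(S_t - ∑ a_j
S_{s_j})² of the best linear predictor. The covariance has a spectral form: up to the factor
`cosineConst (2 * H)`, this error is the integral of g(x)² x^(-1-2H), where g is a combination of
the functions 1 - cos(u x), with coefficient 1 at u = t.

To bound it below, pair g with φ(x) = (1 - cos(r x)) cos(t x) / x², where r = min |t - s_j|. The
cosine transform of the Fejér factor is a triangle supported in [-r, r], so every term with u = s_j
vanishes, whatever its coefficient, and only u = t survives. Cauchy–Schwarz then gives the integral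
≥ const · r^(2H). -/

/-- The constant `∫₀^∞ (1 - cos x) x^{-1-p} dx`, finite and positive for `0 < p < 2`. -/
noncomputable def cosineConst (p : ℝ) : ℝ :=
  ∫ x in Set.Ioi (0 : ℝ), (1 - Real.cos x) * x ^ (-1 - p)

/-! ### Basic cosine integrals -/

theorem integrableOn_one_sub_cos_mul_rpow {p : ℝ} (hp0 : 0 < p) (hp2 : p < 2) (a : ℝ) :
    IntegrableOn (fun x : ℝ => (1 - Real.cos (a * x)) * x ^ (-1 - p)) (Set.Ioi 0) := by
  have hmeas : Measurable fun x : ℝ => (1 - Real.cos (a * x)) * x ^ (-1 - p) := by fun_prop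
  rw [← Set.Ioc_union_Ioi_eq_Ioi zero_le_one]
  refine IntegrableOn.union ?_ ?_
  -- Quadratic vanishing of 1 - cos at 0 needs p < 2; the tail needs only p > 0.
  · have hint : IntegrableOn (fun x : ℝ => a ^ 2 / 2 * x ^ (1 - p)) (Set.Ioc 0 1) := by
      rw [← intervalIntegrable_iff_integrableOn_Ioc_of_le zero_le_one]
      exact (intervalIntegral.intervalIntegrable_rpow' (by linarith)).const_mul _
    refine hint.mono' hmeas.aestronglyMeasurable ?_
    filter_upwards [ae_restrict_mem measurableSet_Ioc] with x hx
    have hx0 : 0 < x := hx.1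
    have h1 : 0 ≤ 1 - Real.cos (a * x) := by linarith [Real.cos_le_one (a * x)]
    have h2 := Real.one_sub_sq_div_two_le_cos (x := a * x)
    rw [Real.norm_of_nonneg (by positivity)]
    have h3 : x ^ (1 - p) = x ^ 2 * x ^ (-1 - p) := by
      rw [← Real.rpow_natCast, ← Real.rpow_add hx0]; norm_num; ring_nf
    rw [h3, ← mul_assoc]
    gcongr
    linarith
  · have hint : IntegrableOn (fun x : ℝ => 2 * x ^ (-1 - p)) (Set.Ioi 1) :=
      (integrableOn_Ioi_rpow_of_lt (by linarith) one_pos).const_mul _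
    refine hint.mono' hmeas.aestronglyMeasurable ?_
    filter_upwards [ae_restrict_mem measurableSet_Ioi] with x hx
    have hx0 : 0 < x := one_pos.trans hx
    have h1 : 0 ≤ 1 - Real.cos (a * x) := by linarith [Real.cos_le_one (a * x)]
    rw [Real.norm_of_nonneg (by positivity)]
    gcongr
    linarith [Real.neg_one_le_cos (a * x)]

theorem cosineConst_pos {p : ℝ} (hp0 : 0 < p) (hp2 : p < 2) : 0 < cosineConst p := by
  have hint : IntegrableOn (fun x : ℝ => (1 - Real.cos x) * x ^ (-1 - p)) (Set.Ioi 0) := by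
    simpa using integrableOn_one_sub_cos_mul_rpow hp0 hp2 1
  have hnn : ∀ x : ℝ, x ∈ Set.Ioi (0 : ℝ) → 0 ≤ (1 - Real.cos x) * x ^ (-1 - p) := fun x hx =>
    mul_nonneg (by linarith [Real.cos_le_one x]) (Real.rpow_nonneg (le_of_lt hx) _)
  rw [cosineConst, setIntegral_pos_iff_support_of_nonneg_ae
    ((ae_restrict_mem measurableSet_Ioi).mono hnn) hint]
  have hsub : Set.Ioo (0 : ℝ) 1 ⊆
      Function.support (fun x : ℝ => (1 - Real.cos x) * x ^ (-1 - p)) ∩ Set.Ioi 0 := by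
    intro x hx
    refine ⟨(mul_pos ?_ (Real.rpow_pos_of_pos hx.1 _)).ne', hx.1⟩
    have h := Real.cos_lt_cos_of_nonneg_of_le_pi le_rfl (by linarith [Real.two_le_pi, hx.2]) hx.1
    rw [Real.cos_zero] at h
    linarith
  exact lt_of_lt_of_le (by simp) (measure_mono hsub)

theorem integral_one_sub_cos_mul_rpow {p : ℝ} (hp0 : 0 < p) (a : ℝ) :
    ∫ x in Set.Ioi (0 : ℝ), (1 - Real.cos (a * x)) * x ^ (-1 - p) = |a| ^ p * cosineConst p := by
  rcases eq_or_ne a 0 with rfl | ha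
  · simp [Real.zero_rpow hp0.ne']
  have hb : 0 < |a| := abs_pos.2 ha
  have hcos : ∀ x : ℝ, Real.cos (a * x) = Real.cos (|a| * x) := fun x => by
    rcases abs_choice a with h | h <;> simp [h]
  have h := integral_comp_mul_left_Ioi' (fun x : ℝ => (1 - Real.cos x) * x ^ (-1 - p)) 0 hb
  simp only [mul_zero, smul_eq_mul] at h
  rw [cosineConst, ← h, ← mul_assoc, ← integral_const_mul]
  refine setIntegral_congr_fun measurableSet_Ioi fun x hx => ?_
  have hx0 : (0 : ℝ) < x := hx
  rw [hcos, Real.mul_rpow hb.le hx0.le]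
  have : |a| ^ p * |a| * |a| ^ (-1 - p) = 1 := by
    nth_rw 2 [← Real.rpow_one |a|]
    rw [← Real.rpow_add hb, ← Real.rpow_add hb]; ring_nf; simp
  linear_combination (-(1 - Real.cos (|a| * x)) * x ^ (-1 - p)) * this

/-! ### The Fejér test function -/

theorem fejer_mul_cos (r v x : ℝ) :
    (1 - Real.cos (r * x)) * Real.cos (v * x) * x ^ (-1 - 1 : ℝ) =
      (-1) * ((1 - Real.cos (v * x)) * x ^ (-1 - 1 : ℝ))
        + (1 / 2) * ((1 - Real.cos ((v + r) * x)) * x ^ (-1 - 1 : ℝ))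
        + (1 / 2) * ((1 - Real.cos ((v - r) * x)) * x ^ (-1 - 1 : ℝ)) := by
  rw [add_mul v, sub_mul v, Real.cos_add, Real.cos_sub]; ring

theorem integrableOn_fejer_mul_cos (r v : ℝ) :
    IntegrableOn (fun x : ℝ => (1 - Real.cos (r * x)) * Real.cos (v * x) * x ^ (-1 - 1 : ℝ))
      (Set.Ioi 0) := by
  have h := integrableOn_one_sub_cos_mul_rpow one_pos one_lt_two
  simp_rw [fejer_mul_cos]
  exact (((h v).const_mul _).add ((h (v + r)).const_mul _)).add ((h (v - r)).const_mul _)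

/-- The Fourier cosine transform of the Fejér kernel is a triangle function. -/
theorem integral_fejer_mul_cos {r : ℝ} (hr : 0 ≤ r) (v : ℝ) :
    ∫ x in Set.Ioi (0 : ℝ), (1 - Real.cos (r * x)) * Real.cos (v * x) * x ^ (-1 - 1 : ℝ) =
      cosineConst 1 * max 0 (r - |v|) := by
  have h := integrableOn_one_sub_cos_mul_rpow one_pos one_lt_two
  simp_rw [fejer_mul_cos]
  rw [integral_add (((h v).const_mul _).fun_add ((h (v + r)).const_mul _)) ((h (v - r)).const_mul _),
    integral_add ((h v).const_mul _) ((h (v + r)).const_mul _)]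
  simp only [integral_const_mul, integral_one_sub_cos_mul_rpow one_pos, Real.rpow_one]
  -- The triangle is half the second difference of |·| with step r.
  have : -|v| + 1 / 2 * |v + r| + 1 / 2 * |v - r| = max 0 (r - |v|) := by
    rcases abs_cases v with ⟨h1, _⟩ | ⟨h1, _⟩ <;> rcases abs_cases (v + r) with ⟨h2, _⟩ | ⟨h2, _⟩ <;>
      rcases abs_cases (v - r) with ⟨h3, _⟩ | ⟨h3, _⟩ <;>
      rcases max_cases 0 (r - |v|) with ⟨h4, _⟩ | ⟨h4, _⟩ <;> rw [h4] <;> linarith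
  linear_combination cosineConst 1 * this

theorem one_sub_cos_mul_fejer (r t u x : ℝ) :
    (1 - Real.cos (u * x)) * ((1 - Real.cos (r * x)) * Real.cos (t * x) * x ^ (-1 - 1 : ℝ)) =
      (1 - Real.cos (r * x)) * Real.cos (t * x) * x ^ (-1 - 1 : ℝ)
      + (-1 / 2) * ((1 - Real.cos (r * x)) * Real.cos ((t + u) * x) * x ^ (-1 - 1 : ℝ))
      + (-1 / 2) * ((1 - Real.cos (r * x)) * Real.cos ((t - u) * x) * x ^ (-1 - 1 : ℝ)) := by
  rw [add_mul t, sub_mul t, Real.cos_add, Real.cos_sub]; ring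

theorem integrableOn_one_sub_cos_mul_fejer (r t u : ℝ) :
    IntegrableOn (fun x : ℝ => (1 - Real.cos (u * x)) *
      ((1 - Real.cos (r * x)) * Real.cos (t * x) * x ^ (-1 - 1 : ℝ))) (Set.Ioi 0) := by
  have h := integrableOn_fejer_mul_cos r
  simp_rw [one_sub_cos_mul_fejer]
  exact ((h t).add ((h (t + u)).const_mul _)).add ((h (t - u)).const_mul _)

theorem integral_one_sub_cos_mul_fejer {r : ℝ} (hr : 0 ≤ r) (t u : ℝ) :
    ∫ x in Set.Ioi (0 : ℝ), (1 - Real.cos (u * x)) *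
      ((1 - Real.cos (r * x)) * Real.cos (t * x) * x ^ (-1 - 1 : ℝ)) =
    cosineConst 1 * (max 0 (r - |t|) - max 0 (r - |t + u|) / 2 - max 0 (r - |t - u|) / 2) := by
  have h := integrableOn_fejer_mul_cos r
  simp_rw [one_sub_cos_mul_fejer]
  rw [integral_add ((h t).fun_add ((h (t + u)).const_mul _)) ((h (t - u)).const_mul _),
    integral_add (h t) ((h (t + u)).const_mul _)]
  simp only [integral_const_mul, integral_fejer_mul_cos hr]
  ring

/-! ### Spectral form of the covariance -/

theorem one_sub_cos_mul_one_sub_cos (u v x w : ℝ) :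
    (1 - Real.cos (u * x)) * (1 - Real.cos (v * x)) * w =
      (1 - Real.cos (u * x)) * w + (1 - Real.cos (v * x)) * w
      + (-1 / 2) * ((1 - Real.cos ((u + v) * x)) * w)
      + (-1 / 2) * ((1 - Real.cos ((v - u) * x)) * w) := by
  rw [add_mul u, sub_mul v, Real.cos_add, Real.cos_sub]; ring

theorem integrableOn_one_sub_cos_mul_one_sub_cos {p : ℝ} (hp0 : 0 < p) (hp2 : p < 2) (u v : ℝ) :
    IntegrableOn (fun x : ℝ =>
      (1 - Real.cos (u * x)) * (1 - Real.cos (v * x)) * x ^ (-1 - p)) (Set.Ioi 0) := by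
  have h := integrableOn_one_sub_cos_mul_rpow hp0 hp2
  simp_rw [one_sub_cos_mul_one_sub_cos]
  exact (((h u).add (h v)).add ((h (u + v)).const_mul _)).add ((h (v - u)).const_mul _)

/-- The spectral representation of the covariance of sub-fractional Brownian motion. -/
theorem integral_one_sub_cos_mul_one_sub_cos {p : ℝ} (hp0 : 0 < p) (hp2 : p < 2) (u v : ℝ) :
    ∫ x in Set.Ioi (0 : ℝ), (1 - Real.cos (u * x)) * (1 - Real.cos (v * x)) * x ^ (-1 - p) =
      cosineConst p * (|u| ^ p + |v| ^ p - (1 / 2) * (|u + v| ^ p + |v - u| ^ p)) := by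
  have h := integrableOn_one_sub_cos_mul_rpow hp0 hp2
  simp_rw [one_sub_cos_mul_one_sub_cos]
  rw [integral_add (((h u).fun_add (h v)).fun_add ((h (u + v)).const_mul _)) ((h (v - u)).const_mul _),
    integral_add ((h u).fun_add (h v)) ((h (u + v)).const_mul _), integral_add (h u) (h v)]
  simp only [integral_const_mul, integral_one_sub_cos_mul_rpow hp0]
  ring

theorem sq_sum_mul_one_sub_cos {ι : Type*} [Fintype ι] (c u : ι → ℝ) (x w : ℝ) :
    (∑ i, c i * (1 - Real.cos (u i * x))) ^ 2 * w =
      ∑ i, ∑ j, c i * c j * ((1 - Real.cos (u i * x)) * (1 - Real.cos (u j * x)) * w) := by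
  rw [sq, Finset.sum_mul_sum, Finset.sum_mul]
  refine Finset.sum_congr rfl fun i _ => ?_
  rw [Finset.sum_mul]
  exact Finset.sum_congr rfl fun j _ => by ring

theorem integrableOn_sq_sum_one_sub_cos {ι : Type*} [Fintype ι] {p : ℝ} (hp0 : 0 < p) (hp2 : p < 2)
    (c u : ι → ℝ) :
    IntegrableOn (fun x : ℝ => (∑ i, c i * (1 - Real.cos (u i * x))) ^ 2 * x ^ (-1 - p))
      (Set.Ioi 0) := by
  simp_rw [sq_sum_mul_one_sub_cos]
  exact integrable_finsetSum _ fun i _ => integrable_finsetSum _ fun j _ =>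
    (integrableOn_one_sub_cos_mul_one_sub_cos hp0 hp2 _ _).const_mul _

theorem integral_sq_sum_one_sub_cos {ι : Type*} [Fintype ι] {p : ℝ} (hp0 : 0 < p) (hp2 : p < 2)
    (c u : ι → ℝ) :
    ∫ x in Set.Ioi (0 : ℝ), (∑ i, c i * (1 - Real.cos (u i * x))) ^ 2 * x ^ (-1 - p) =
      cosineConst p * ∑ i, ∑ j, c i * c j *
        (|u i| ^ p + |u j| ^ p - (1 / 2) * (|u i + u j| ^ p + |u j - u i| ^ p)) := by
  have h := fun i j => (integrableOn_one_sub_cos_mul_one_sub_cos hp0 hp2 (u i) (u j)).const_mul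
    (c i * c j)
  simp_rw [sq_sum_mul_one_sub_cos]
  rw [integral_finsetSum _ fun i _ => integrable_finsetSum _ fun j _ => h i j, Finset.mul_sum]
  refine Finset.sum_congr rfl fun i _ => ?_
  rw [integral_finsetSum _ fun j _ => h i j, Finset.mul_sum]
  refine Finset.sum_congr rfl fun j _ => ?_
  rw [integral_const_mul, integral_one_sub_cos_mul_one_sub_cos hp0 hp2]
  ring

/-! ### Lower bound for the spectral integral -/

/-- Cauchy–Schwarz for the pairing of g with φ, in the form -2ab ≤ μa² + μ⁻¹b² with μ left free. -/
theorem mul_le_integral_sq_sum_one_sub_cos {ι : Type*} [Fintype ι] {p : ℝ} (hp0 : 0 < p)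
    (hp2 : p < 2) (c u : ι → ℝ) (i₀ : ι) (hc : c i₀ = 1) (hu : ∀ i, 0 ≤ u i) {r : ℝ} (hr : 0 < r)
    (hr0 : r ≤ u i₀) (hri : ∀ i, i ≠ i₀ → r ≤ |u i₀ - u i|) {μ : ℝ} (hμ : 0 < μ) :
    cosineConst 1 * r ≤
      μ * (∫ x in Set.Ioi (0 : ℝ), (∑ i, c i * (1 - Real.cos (u i * x))) ^ 2 * x ^ (-1 - p))
        + μ⁻¹ * (2 * (r ^ (2 - p) * cosineConst (2 - p))) := by
  set t := u i₀ with ht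
  have hF := fun i => (integrableOn_one_sub_cos_mul_fejer r t (u i)).const_mul (c i)
  -- The triangle is evaluated at t, t + u and t - u, all at distance ≥ r from 0 except t - u when i
  -- = i₀.
  have hval : ∫ x in Set.Ioi (0 : ℝ), (∑ i, c i * (1 - Real.cos (u i * x))) *
      ((1 - Real.cos (r * x)) * Real.cos (t * x) * x ^ (-1 - 1 : ℝ)) = -(cosineConst 1 * r / 2) := by
    simp_rw [Finset.sum_mul, mul_assoc (c _)]
    rw [integral_finsetSum _ fun i _ => hF i, Finset.sum_eq_single i₀]
    · rw [integral_const_mul, integral_one_sub_cos_mul_fejer hr.le, hc, ← ht, sub_self, abs_zero,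
        abs_of_nonneg (show 0 ≤ t by linarith), abs_of_nonneg (show 0 ≤ t + t by linarith),
        max_eq_left (by linarith), max_eq_left (by linarith), max_eq_right (by linarith)]
      ring
    · intro i _ hi
      have h1 := hri i hi
      have h2 := hu i
      rw [integral_const_mul, integral_one_sub_cos_mul_fejer hr.le,
        abs_of_nonneg (show 0 ≤ t by linarith), abs_of_nonneg (show 0 ≤ t + u i by linarith),
        max_eq_left (by linarith), max_eq_left (by linarith), max_eq_left (by linarith)]
      ring
    · simp
  have hG := (integrableOn_sq_sum_one_sub_cos hp0 hp2 c u).const_mul μ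
  have hK := ((integrableOn_one_sub_cos_mul_rpow (p := 2 - p) (by linarith) (by linarith)
    r).const_mul 2).const_mul μ⁻¹
  have hL : IntegrableOn (fun x : ℝ => (-2) * ((∑ i, c i * (1 - Real.cos (u i * x))) *
      ((1 - Real.cos (r * x)) * Real.cos (t * x) * x ^ (-1 - 1 : ℝ)))) (Set.Ioi 0) := by
    simp_rw [Finset.sum_mul, mul_assoc (c _)]
    exact (integrable_finsetSum _ fun i _ => hF i).const_mul _
  have hmono := setIntegral_mono_on hL (hG.add hK) measurableSet_Ioi ?_
  · simp only [Pi.add_apply] at hmono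
    rw [integral_add hG hK] at hmono
    simp only [integral_const_mul, hval] at hmono
    rw [integral_one_sub_cos_mul_rpow (by linarith), abs_of_pos hr] at hmono
    linarith
  · intro x hx
    have hx0 : (0 : ℝ) < x := hx
    simp only [Pi.add_apply]
    set g := ∑ i, c i * (1 - Real.cos (u i * x))
    -- Splits x^(-2) = αβ, so that g carries the weight α² = x^(-1-p) and φ the dual weight with p
    -- replaced by 2 - p.
    set α := x ^ ((-1 - p) / 2) with hα
    set β := x ^ ((-1 - (2 - p)) / 2) with hβ
    have h1 : x ^ (-1 - p) = α ^ 2 := by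
      rw [hα, ← Real.rpow_natCast, ← Real.rpow_mul hx0.le]; norm_num
    have h2 : x ^ (-1 - (2 - p)) = β ^ 2 := by
      rw [hβ, ← Real.rpow_natCast, ← Real.rpow_mul hx0.le]; norm_num
    have h3 : x ^ (-1 - 1 : ℝ) = α * β := by
      rw [hα, hβ, ← Real.rpow_add hx0]; ring_nf
    rw [h1, h2, h3]
    have hC := Real.cos_le_one (r * x)
    have hC' := Real.neg_one_le_cos (r * x)
    have hT := Real.cos_sq_le_one (t * x)
    set C := Real.cos (r * x)
    set T := Real.cos (t * x)
    have hk : ((1 - C) * T) ^ 2 ≤ 2 * (1 - C) := by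
      have : (1 - C) ^ 2 ≤ 2 * (1 - C) := by nlinarith
      nlinarith [mul_nonneg (sq_nonneg (1 - C)) (sub_nonneg.2 hT)]
    have hk' : μ⁻¹ * (((1 - C) * T) ^ 2 * β ^ 2) ≤ μ⁻¹ * (2 * (1 - C) * β ^ 2) := by gcongr
    have hsq : 0 ≤ μ⁻¹ * (μ * (g * α) + (1 - C) * T * β) ^ 2 := by positivity
    have hμ1 : μ⁻¹ * μ = 1 := inv_mul_cancel₀ hμ.ne'
    have hexp : μ⁻¹ * (μ * (g * α) + (1 - C) * T * β) ^ 2 = μ * (g ^ 2 * α ^ 2)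
        + 2 * (g * ((1 - C) * T * (α * β))) + μ⁻¹ * (((1 - C) * T) ^ 2 * β ^ 2) := by
      linear_combination (μ * (g * α) ^ 2 + 2 * (g * ((1 - C) * T * (α * β)))) * hμ1
    linarith

theorem rpow_le_integral_sq_sum_one_sub_cos {ι : Type*} [Fintype ι] {p : ℝ} (hp0 : 0 < p)
    (hp2 : p < 2) (c u : ι → ℝ) (i₀ : ι) (hc : c i₀ = 1) (hu : ∀ i, 0 ≤ u i) {r : ℝ} (hr : 0 < r)
    (hr0 : r ≤ u i₀) (hri : ∀ i, i ≠ i₀ → r ≤ |u i₀ - u i|) :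
    cosineConst 1 ^ 2 / (8 * cosineConst (2 - p)) * r ^ p ≤
      ∫ x in Set.Ioi (0 : ℝ), (∑ i, c i * (1 - Real.cos (u i * x))) ^ 2 * x ^ (-1 - p) := by
  have hD : 0 < cosineConst 1 := cosineConst_pos one_pos one_lt_two
  have hE : 0 < cosineConst (2 - p) := cosineConst_pos (by linarith) (by linarith)
  have hrp : 0 < r ^ p := Real.rpow_pos_of_pos hr p
  -- The optimal μ: it makes the second term half of the left-hand side.
  have hμ : 0 < 4 * cosineConst (2 - p) * r / (cosineConst 1 * r ^ p) := by positivity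
  have h := mul_le_integral_sq_sum_one_sub_cos hp0 hp2 c u i₀ hc hu hr hr0 hri hμ
  set I := ∫ x in Set.Ioi (0 : ℝ), (∑ i, c i * (1 - Real.cos (u i * x))) ^ 2 * x ^ (-1 - p)
  have h2p : r ^ (2 - p) = r ^ 2 / r ^ p := by rw [Real.rpow_sub hr]; norm_num
  have h1 : (4 * cosineConst (2 - p) * r / (cosineConst 1 * r ^ p))⁻¹ *
      (2 * (r ^ (2 - p) * cosineConst (2 - p))) = cosineConst 1 * r / 2 := by
    rw [h2p]; field_simp; norm_num
  rw [h1] at h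
  have h3 : cosineConst 1 * r / 2 ≤ 4 * cosineConst (2 - p) * r / (cosineConst 1 * r ^ p) * I := by
    linarith
  have h4 : I = (cosineConst 1 * r ^ p) / (4 * cosineConst (2 - p) * r) *
      (4 * cosineConst (2 - p) * r / (cosineConst 1 * r ^ p) * I) := by
    field_simp
  rw [h4]
  calc _ = (cosineConst 1 * r ^ p) / (4 * cosineConst (2 - p) * r) * (cosineConst 1 * r / 2) := by
        field_simp; norm_num
    _ ≤ _ := by gcongr

/-! ### Gaussian conditional variance -/

/-- The linear projection of a square-integrable variable on finitely many others. -/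
theorem exists_integral_sub_sum_mul_eq_zero {Ω ι : Type*} [Fintype ι] {mΩ : MeasurableSpace Ω}
    {P : Measure Ω} {X : Ω → ℝ} {Y : ι → Ω → ℝ} (hX : MemLp X 2 P) (hY : ∀ j, MemLp (Y j) 2 P) :
    ∃ a : ι → ℝ, ∀ k, ∫ ω, (X ω - ∑ j, a j * Y j ω) * Y k ω ∂P = 0 := by
  set V : ι → Lp ℝ 2 P := fun j => (hY j).toLp with hV
  set W : Submodule ℝ (Lp ℝ 2 P) := Submodule.span ℝ (Set.range V) with hW
  have : FiniteDimensional ℝ W := FiniteDimensional.span_of_finite ℝ (Set.finite_range V)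
  obtain ⟨a, ha⟩ := (Submodule.mem_span_range_iff_exists_fun ℝ).1
    (W.starProjection_apply_mem (hX.toLp : Lp ℝ 2 P))
  refine ⟨a, fun k => ?_⟩
  have horth := W.starProjection_inner_eq_zero (hX.toLp : Lp ℝ 2 P) (V k)
    (Submodule.subset_span ⟨k, rfl⟩)
  rw [← ha, L2.inner_def] at horth
  rw [← horth]
  refine integral_congr_ae ?_
  have hsum : ((∑ j, a j • V j : Lp ℝ 2 P) : Ω → ℝ) =ᵐ[P] fun ω => ∑ j, a j * Y j ω := by
    have h1 := Lp.coeFn_finsetSum (μ := P) (p := 2) Finset.univ (fun j => a j • V j)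
    have h2 : ∀ j, ((a j • V j : Lp ℝ 2 P) : Ω → ℝ) =ᵐ[P] fun ω => a j * Y j ω := fun j => by
      filter_upwards [Lp.coeFn_smul (a j) (V j), (hY j).coeFn_toLp] with ω h h'
      rw [h, Pi.smul_apply, smul_eq_mul, h']
    filter_upwards [h1, ae_all_iff.2 h2] with ω h h'
    rw [h, Finset.sum_apply]
    exact Finset.sum_congr rfl fun j _ => h' j
  filter_upwards [Lp.coeFn_sub (hX.toLp : Lp ℝ 2 P) (∑ j, a j • V j), hX.coeFn_toLp, hsum,
    (hY k).coeFn_toLp] with ω h1 h2 h3 h4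
  rw [h1, Pi.sub_apply, h2, h3, h4]
  simp [mul_comm]

/-- For a centered Gaussian process the conditional variance given finitely many values is almost
surely the mean square error of the best linear predictor. -/
theorem exists_condVar_sigmaOfValues_ae_eq {Ω : Type*} {mΩ : MeasurableSpace Ω} {P : Measure Ω}
    [IsProbabilityMeasure P] {S : ℝ≥0 → Ω → ℝ} (hmeas : ∀ t, Measurable (S t))
    (hS : IsGaussianProcess S P) (h0 : ∀ t, ∫ ω, S t ω ∂P = 0) {m : ℕ} (s : Fin m → ℝ≥0)
    (t : ℝ≥0) :
    ∃ a : Fin m → ℝ, condVar (sigmaOfValues S s) (S t) P =ᵐ[P]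
      fun _ => ∫ ω, (S t ω - ∑ j, a j * S (s j) ω) ^ 2 ∂P := by
  have hL2 : ∀ t, MemLp (S t) 2 P := fun t => (hS.hasGaussianLaw_eval t).memLp_two
  obtain ⟨a, ha⟩ := exists_integral_sub_sum_mul_eq_zero (hL2 t) fun j => hL2 (s j)
  refine ⟨a, ?_⟩
  set F : Ω → ℝ := fun ω => ∑ j, a j * S (s j) ω with hF
  set R : Ω → ℝ := fun ω => S t ω - F ω with hR
  have hFm : Measurable F := by fun_prop
  have hRm : Measurable R := by fun_prop
  have hF2 : MemLp F 2 P := memLp_finsetSum _ fun j _ => (hL2 (s j)).const_mul (a j)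
  have hR2 : MemLp R 2 P := (hL2 t).sub hF2
  have hF0 : ∫ ω, F ω ∂P = 0 := by
    rw [hF, integral_finsetSum _ fun j _ => ((hL2 (s j)).integrable one_le_two).const_mul (a j)]
    simp [integral_const_mul, h0]
  have hR0 : ∫ ω, R ω ∂P = 0 := by
    rw [hR, integral_sub ((hL2 t).integrable one_le_two) (hF2.integrable one_le_two), h0, hF0,
      sub_zero]
  have hle : sigmaOfValues S s ≤ mΩ := iSup_le fun j => (hmeas (s j)).comap_le
  have hjoint : IsGaussianProcess (Sum.elim (fun _ : Unit => R) fun j => S (s j)) P := by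
    classical
    refine hS.of_isGaussianProcess fun i => ?_
    rcases i with _ | j
    · refine ⟨insert t (Finset.univ.image s),
        ContinuousLinearMap.proj ⟨t, Finset.mem_insert_self _ _⟩ -
          ∑ j, a j • ContinuousLinearMap.proj ⟨s j, Finset.mem_insert_of_mem
            (Finset.mem_image_of_mem s (Finset.mem_univ j))⟩, fun ω => ?_⟩
      simp [hR, hF]
    · exact ⟨{s j}, ContinuousLinearMap.proj ⟨s j, Finset.mem_singleton_self _⟩, fun ω => by simp⟩
  -- The residual is jointly Gaussian with the observations and uncorrelated with them, hence
  -- independent.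
  have hindep : IndepFun (fun ω (_ : Unit) => R ω) (fun ω j => S (s j) ω) P := by
    refine hjoint.indepFun_of_covariance_eq_zero (X := fun _ : Unit => R)
      (fun _ => hRm.aemeasurable) (fun j => (hmeas _).aemeasurable) fun _ k => ?_
    rw [covariance_eq_sub hR2 (hL2 (s k)), hR0, zero_mul, sub_zero]
    exact ha k
  have hIndep : Indep (MeasurableSpace.comap R inferInstance) (sigmaOfValues S s) P := by
    have h : IndepFun R (fun ω j => S (s j) ω) P :=
      hindep.comp (φ := fun f : Unit → ℝ => f ()) (ψ := id) (measurable_pi_apply ()) measurable_id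
    have hsig : MeasurableSpace.comap (fun ω j => S (s j) ω) MeasurableSpace.pi =
        sigmaOfValues S s := by
      simp [sigmaOfValues, MeasurableSpace.pi, MeasurableSpace.comap_iSup,
        MeasurableSpace.comap_comp, Function.comp_def]
    rw [← hsig]
    exact h
  have hRsm : StronglyMeasurable[MeasurableSpace.comap R inferInstance] R :=
    (comap_measurable R).stronglyMeasurable
  have hFsm : StronglyMeasurable[sigmaOfValues S s] F := by
    refine Finset.stronglyMeasurable_fun_sum _ fun j _ => ?_
    have : Measurable[sigmaOfValues S s] (S (s j)) :=
      (comap_measurable (S (s j))).mono (le_iSup (fun j => MeasurableSpace.comap (S (s j)) _) j)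
        le_rfl
    exact (this.const_mul _).stronglyMeasurable
  have hcondR : P[R | sigmaOfValues S s] =ᵐ[P] fun _ => 0 := by
    have := condExp_indep_eq hRm.comap_le hle hRsm hIndep
    rwa [hR0] at this
  have hcond : P[S t | sigmaOfValues S s] =ᵐ[P] F := by
    have hadd := condExp_add (hR2.integrable one_le_two) (hF2.integrable one_le_two)
      (sigmaOfValues S s)
    have hsplit : R + F = S t := by ext ω; simp [hR]
    rw [hsplit, condExp_of_stronglyMeasurable hle hFsm (hF2.integrable one_le_two)] at hadd
    filter_upwards [hadd, hcondR] with ω h1 h2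
    rw [h1, Pi.add_apply, h2, zero_add]
  have hsq : (S t - P[S t | sigmaOfValues S s]) ^ 2 =ᵐ[P] fun ω => R ω ^ 2 := by
    filter_upwards [hcond] with ω h
    simp [h, hR]
  exact (condExp_congr_ae hsq).trans
    (condExp_indep_eq hRm.comap_le hle (hRsm.pow 2) hIndep)

/-! ### Strong local nondeterminism -/

theorem IsSubFractionalBrownianMotion.cosineConst_mul_integral_sq_sum {Ω ι : Type*} [Fintype ι]
    {mΩ : MeasurableSpace Ω} {P : Measure Ω} {H : ℝ} {S : ℝ≥0 → Ω → ℝ}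
    (hS : IsSubFractionalBrownianMotion H S P) (hH0 : 0 < H) (hH1 : H < 1)
    (c : ι → ℝ) (u : ι → ℝ≥0) :
    cosineConst (2 * H) * ∫ ω, (∑ i, c i * S (u i) ω) ^ 2 ∂P =
      ∫ x in Set.Ioi (0 : ℝ),
        (∑ i, c i * (1 - Real.cos ((u i : ℝ) * x))) ^ 2 * x ^ (-1 - 2 * H) := by
  have hL2 : ∀ t, MemLp (S t) 2 P := fun t => (hS.isGaussianProcess.hasGaussianLaw_eval t).memLp_two
  have hint : ∀ i j, Integrable (fun ω => c i * c j * (S (u i) ω * S (u j) ω)) P := fun i j =>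
    ((hL2 (u i)).integrable_mul (hL2 (u j))).const_mul _
  rw [integral_sq_sum_one_sub_cos (by linarith) (by linarith)]
  congr 1
  have hsq : ∀ ω, (∑ i, c i * S (u i) ω) ^ 2 =
      ∑ i, ∑ j, c i * c j * (S (u i) ω * S (u j) ω) := fun ω => by
    rw [sq, Finset.sum_mul_sum]
    exact Finset.sum_congr rfl fun i _ => Finset.sum_congr rfl fun j _ => by ring
  simp_rw [hsq]
  rw [integral_finsetSum _ fun i _ => integrable_finsetSum _ fun j _ => hint i j]
  refine Finset.sum_congr rfl fun i _ => ?_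
  rw [integral_finsetSum _ fun j _ => hint i j]
  refine Finset.sum_congr rfl fun j _ => ?_
  have hi := (u i).coe_nonneg
  have hj := (u j).coe_nonneg
  rw [integral_const_mul, hS.covariance_eq, abs_of_nonneg hi, abs_of_nonneg hj,
    abs_of_nonneg (add_nonneg hi hj)]

theorem corollaryA3 (H : ℝ) (hH0 : 0 < H) (hH1 : H < 1) :
    ∃ κ : ℝ, 0 < κ ∧
      ∀ {Ω : Type*} {mΩ : MeasurableSpace Ω} (P : Measure Ω) [IsProbabilityMeasure P]
        (S : ℝ≥0 → Ω → ℝ), IsSubFractionalBrownianMotion H S P →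
      ∀ (m : ℕ) (hm : 1 ≤ m) (s : Fin m → ℝ≥0) (t : ℝ≥0),
        Monotone s → (∀ j, 0 < s j) → (∀ j, s j < t) →
        ∀ᵐ ω ∂P,
          κ * Finset.univ.inf' ⟨⟨0, hm⟩, Finset.mem_univ _⟩
              (fun j : Fin m => |(t : ℝ) - (s j : ℝ)| ^ (2 * H))
            ≤ condVar (sigmaOfValues S s) (S t) P ω := by
  have hD : 0 < cosineConst 1 := cosineConst_pos one_pos one_lt_two
  have hE : 0 < cosineConst (2 - 2 * H) := cosineConst_pos (by linarith) (by linarith)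
  have hC : 0 < cosineConst (2 * H) := cosineConst_pos (by linarith) (by linarith)
  refine ⟨cosineConst 1 ^ 2 / (8 * cosineConst (2 - 2 * H)) / cosineConst (2 * H),
    by positivity, ?_⟩
  intro Ω mΩ P _ S hS m hm s t _ hs0 hst
  obtain ⟨a, ha⟩ := exists_condVar_sigmaOfValues_ae_eq hS.measurable hS.isGaussianProcess
    hS.centered s t
  filter_upwards [ha] with ω hω
  rw [hω]
  obtain ⟨j₀, -, hj₀⟩ := Finset.exists_min_image Finset.univ (fun j => |(t : ℝ) - (s j : ℝ)|)
    ⟨(⟨0, hm⟩ : Fin m), Finset.mem_univ _⟩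
  have hst' : ∀ j, (s j : ℝ) < t := fun j => NNReal.coe_lt_coe.2 (hst j)
  have hr : 0 < |(t : ℝ) - s j₀| := abs_pos.2 (sub_pos.2 (hst' j₀)).ne'
  -- `none` indexes the time t, with coefficient 1; `some j` indexes s_j.
  let c : Option (Fin m) → ℝ := fun i => i.elim 1 fun j => -a j
  let u : Option (Fin m) → ℝ≥0 := fun i => i.elim t s
  have hlow := rpow_le_integral_sq_sum_one_sub_cos (p := 2 * H) (by linarith) (by linarith) c
    (fun i => (u i : ℝ)) none rfl (fun i => (u i).coe_nonneg) hr
    -- r ≤ t holds because s_{j₀} ≥ 0: time 0 acts as one more observed point.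
    (by
      rw [abs_of_pos (sub_pos.2 (hst' j₀))]
      exact sub_le_self _ (s j₀).coe_nonneg)
    (by
      rintro (_ | j) hj
      · exact absurd rfl hj
      · exact hj₀ j (Finset.mem_univ j))
  rw [← hS.cosineConst_mul_integral_sq_sum hH0 hH1] at hlow
  have hsum : ∀ ω, ∑ i, c i * S (u i) ω = S t ω - ∑ j, a j * S (s j) ω := fun ω => by
    simp [Fintype.sum_option, c, u, sub_eq_add_neg]
  simp_rw [hsum] at hlow
  rw [div_mul_eq_mul_div, div_le_iff₀' hC]
  refine le_trans ?_ hlow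
  gcongr
  exact Finset.inf'_le _ (Finset.mem_univ j₀)
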